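/- For a finitely generated group $G$ let $m(G)$ be the least $d$ such that $G$ has a faithful representation into $GL(d,\mathbb F)$ for some field $\mathbb F$, and for $p=0$ or $p$ prime let $m_p(G)$ be the least such $d$ when $\mathbb F$ ranges over the fields of characteristic $p$ (with value $\infty$ if there is no such representation). Let $$\mathcal R=\langle G,Q,P,F \mid [G,Q]=[Q,P]=[P,F]=1\rangle$$ be the right angled Artin group on the path with 4 vertices. Over a field $\mathbb F$ call a quadruple of $3\times 3$ matrices $(G_0,Q_0,P_0,F_0)$ admissible if $$G_0=\begin{pmatrix}a&b&0\\c&d&0\\0&0&1\end{pmatrix},\quad Q_0=\begin{pmatrix}\lambda&0&0\\0&\lambda&0\\0&0&\lambda^{-1}\end{pmatrix},\quad P_0=\begin{pmatrix}\lambda&0&0\\0&\lambda^{-1}&0\\0&0&\lambda\end{pmatrix},\quad F_0=\begin{pmatrix}\alpha&0&\beta\\0&1&0\\\gamma&0&\delta\end{pmatrix}$$ for some $a,b,c,d,\alpha,\beta,\gamma,\delta,\lambda\in\mathbb F$ with $ad-bc$, $\alpha\delta-\beta\gamma$ and $\lambda$ non-zero, such that (1) for every integer $n\neq 0$ both off-diagonal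 entries of $\begin{pmatrix}\alpha&\beta\\\gamma&\delta\end{pmatrix}^n$ are non-zero; (2) the matrices $\begin{pmatrix}a&b\\c&d\end{pmatrix}$ and $\begin{pmatrix}\lambda&0\\0&\lambda^{-1}\end{pmatrix}$ freely generate a free group of rank 2, and the only matrix in this group with top left hand entry equal to $1$ is the identity $I_2$. Then the following hold. (i) Admissible quadruples exist over $\mathbb C$, and over every algebraically closed field of prime characteristic which has infinite transcendence degree over its prime subfield. (ii) Explicitly, if $\mathbb F$ is any field (of any characteristic) and $t,\lambda\in\mathbb F$ are algebraically independent over the prime subfield of $\mathbb F$, then the matrices above with this $\lambda$ and $$\begin{pmatrix}a&b\\c&d\end{pmatrix}=\begin{pmatrix}\alpha&\beta\\\gamma&\delta\end{pmatrix}=\begin{pmatrix}t^2&t-1\\t+1&1\end{pmatrix}^2=\begin{pmatrix}t^4+t^2-1&(t-1)(t^2+1)\\(t+1)(t^2+1)&t^2\end{pmatrix}$$ form an admissible quadruple. (iii) $m(\mathcal R)=3$, and $m_p(\mathcal R)=3$ for every $p$ that is zero or prime. -/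

import Mathlib

open scoped MatrixGroups

universe u

/-- The right angled Artin group of a simple graph: one generator for each vertex, and two
generators commute whenever the vertices are joined by an edge. -/
def RAAG {V : Type*} (Γ : SimpleGraph V) : Type _ :=
  PresentedGroup {r : FreeGroup V | ∃ v w : V, Γ.Adj v w ∧
    r = FreeGroup.of v * FreeGroup.of w * (FreeGroup.of v)⁻¹ * (FreeGroup.of w)⁻¹}

instance {V : Type*} (Γ : SimpleGraph V) : Group (RAAG Γ) :=
  inferInstanceAs (Group (PresentedGroup _))

/-- The right angled Artin group on the path with 4 vertices. -/
abbrev PathRAAG : Type := RAAG (SimpleGraph.pathGraph 4)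

/-- `m(G)`: the least `d` such that `G` has a faithful representation into `GL(d, F)` for some
field `F`; it is `⊤` if there is none. -/
noncomputable def minDim (G : Type*) [Group G] : ℕ∞ :=
  sInf {k : ℕ∞ | ∃ d : ℕ, k = d ∧ ∃ (F : Type u) (_ : Field F) (ρ : G →* GL (Fin d) F),
    Function.Injective ρ}

/-- `m_p(G)`: the least `d` such that `G` has a faithful representation into `GL(d, F)` for some
field `F` of characteristic `p`; it is `⊤` if there is none. -/
noncomputable def minDimChar (p : ℕ) (G : Type*) [Group G] : ℕ∞ :=
  sInf {k : ℕ∞ | ∃ d : ℕ, k = d ∧ ∃ (F : Type u) (_ : Field F) (_ : CharP F p)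
    (ρ : G →* GL (Fin d) F), Function.Injective ρ}

/-- A universal coefficient domain: an algebraically closed field of infinite transcendence
degree over its prime subfield (the least subfield `⊥`). -/
def IsUniversalDomain (F : Type*) [Field F] : Prop :=
  IsAlgClosed F ∧ Cardinal.aleph0 ≤ Algebra.trdeg (⊥ : Subfield F) F

/-- The invertible matrix with rows `(a, b)` and `(c, d)`. -/
def gl2 {F : Type*} [Field F] (a b c d : F) (h : a * d - b * c ≠ 0) : GL (Fin 2) F :=
  Matrix.GeneralLinearGroup.mkOfDetNeZero !![a, b; c, d] (by rwa [Matrix.det_fin_two_of])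

/-- The diagonal matrix with entries `l` and `l⁻¹`. -/
def diagInv {F : Type*} [Field F] (l : F) (h : l ≠ 0) : GL (Fin 2) F :=
  gl2 l 0 0 l⁻¹ (by simp [h])

/-- No non-trivial power of `Z` has an off-diagonal entry equal to zero. -/
def Condition1 {F : Type*} [Field F] (Z : GL (Fin 2) F) : Prop :=
  ∀ n : ℤ, n ≠ 0 → (Z ^ n) 0 1 ≠ 0 ∧ (Z ^ n) 1 0 ≠ 0

/-- `X` and `Y` generate a free group of rank 2, freely, and the only matrix in this group with
top left entry equal to `1` is the identity. -/
def Condition2 {F : Type*} [Field F] (X Y : GL (Fin 2) F) : Prop :=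
  Function.Injective (FreeGroup.lift ![X, Y]) ∧
    ∀ M ∈ Subgroup.closure {X, Y}, M 0 0 = 1 → M = 1

/-- The quadruple `(G₀, Q₀, P₀, F₀)` has the prescribed shape, with the blocks invertible, and
satisfies both conditions. -/
def AdmissibleQuadruple {F : Type*} [Field F] (G₀ Q₀ P₀ F₀ : Matrix (Fin 3) (Fin 3) F) : Prop :=
  ∃ (a b c d α β γ δ l : F) (hX : a * d - b * c ≠ 0) (hZ : α * δ - β * γ ≠ 0) (hl : l ≠ 0),
    G₀ = !![a, b, 0; c, d, 0; 0, 0, 1] ∧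
    Q₀ = !![l, 0, 0; 0, l, 0; 0, 0, l⁻¹] ∧
    P₀ = !![l, 0, 0; 0, l⁻¹, 0; 0, 0, l] ∧
    F₀ = !![α, 0, β; 0, 1, 0; γ, 0, δ] ∧
    Condition1 (gl2 α β γ δ hZ) ∧
    Condition2 (gl2 a b c d hX) (diagInv l hl)

/-! Faithfulness in dimension 3 comes from tracking lowest-order terms. Conjugate the block matrices
of G, Q, P by `I - E₃₁` and that of F by `diag(s⁻¹, 1, 1)`, where s is transcendental over the base
field. P stays diagonal with equal first and third entries, so all relations survive. The lowest
term of F^n is s⁻¹ (Z^n)₁₂ E₁₃, nonzero by condition (1). In a product F^n₁ a₁ F^n₂ a₂ ⋯ with aᵢ in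
⟨G, Q, P⟩, the lowest terms multiply to something nonzero as soon as each inner aᵢ has nonzero (3,1)
entry. The conjugation turns that entry into a difference of two diagonal entries, and condition (2)
lets it vanish only for aᵢ in ⟨P⟩, which commutes with F and can be absorbed. So a negative power of
s survives (`pathRep_injective`).

Condition (2) for the explicit pair follows by the same method with l in the role of s, comparing
expansions in l and in l⁻¹ (`eq_one_of_lift_apply_eq_one`). The input is that all entries of Z^n, n
≠ 0, are nonconstant polynomials in t (`natDegree_polyMatrix_sq_zpow_pos`).

For the lower bound, a nonscalar 2 × 2 matrix has commutative centraliser. Q commutes with the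
non-commuting G and P, so its image would be scalar, although Q does not commute with F
(`three_le_of_injective`). -/

/-! ### Lowest-order terms in a transcendental element. -/

/-- `u = s ^ e * p(s)` for a polynomial `p` over `k` with constant coefficient `c`. -/
def HasLead {k K : Type*} [CommRing k] [Field K] [Algebra k K] (s : K) (e : ℤ) (u : K) (c : k) :
    Prop :=
  ∃ p : Polynomial k, u = s ^ e * Polynomial.aeval s p ∧ p.coeff 0 = c

namespace HasLead

variable {k K : Type*} [CommRing k] [Field K] [Algebra k K] {s : K}

theorem of_algebraMap (c : k) : HasLead s 0 (algebraMap k K c) c :=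
  ⟨Polynomial.C c, by simp, by simp⟩

theorem zpow (hs : s ≠ 0) {e n : ℤ} (h : e ≤ n) :
    HasLead s e (s ^ n) (if n = e then (1 : k) else 0) := by
  obtain ⟨m, hm⟩ := Int.eq_ofNat_of_zero_le (sub_nonneg.2 h)
  obtain rfl : n = e + m := by omega
  refine ⟨Polynomial.X ^ m, by simp [zpow_add₀ hs], ?_⟩
  simp [Polynomial.coeff_X_pow, eq_comm]

theorem mul (hs : s ≠ 0) {e e' : ℤ} {u u' : K} {c c' : k} (h : HasLead s e u c)
    (h' : HasLead s e' u' c') : HasLead s (e + e') (u * u') (c * c') := by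
  obtain ⟨p, rfl, rfl⟩ := h
  obtain ⟨q, rfl, rfl⟩ := h'
  exact ⟨p * q, by rw [zpow_add₀ hs, map_mul]; ring, by simp [Polynomial.mul_coeff_zero]⟩

theorem sum {e : ℤ} {ι : Type*} (t : Finset ι) {u : ι → K} {c : ι → k}
    (h : ∀ i, HasLead s e (u i) (c i)) : HasLead s e (∑ i ∈ t, u i) (∑ i ∈ t, c i) := by
  choose p hp hc using h
  exact ⟨∑ i ∈ t, p i, by simp [hp, Finset.mul_sum], by simp [hc]⟩

/-- Since the coefficient may be zero, these bounds multiply freely. Non-vanishing is checked only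
afterwards, on the product of the coefficient matrices. -/
theorem matrix_mul (hs : s ≠ 0) {n : Type*} [Fintype n] {e e' : ℤ} {M M' : Matrix n n K}
    {C C' : Matrix n n k} (h : ∀ i j, HasLead s e (M i j) (C i j))
    (h' : ∀ i j, HasLead s e' (M' i j) (C' i j)) (i j : n) :
    HasLead s (e + e') ((M * M') i j) ((C * C') i j) := by
  simp only [Matrix.mul_apply]
  exact sum _ fun l => (h i l).mul hs (h' l j)

/-- Transcendence makes the expansion unique, so `p` is divisible by a positive power of `X`. -/
theorem eq_zero_of_lt (hs : Transcendental k s) {e e' : ℤ} {u : K} {c c' : k}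
    (h : HasLead s e u c) (h' : HasLead s e' u c') (hlt : e < e') : c = 0 := by
  obtain ⟨p, hp, rfl⟩ := h
  obtain ⟨q, hq, -⟩ := h'
  have hs0 : s ≠ 0 := by
    rintro rfl
    have := (algebraMap k K).domain_nontrivial
    exact hs isAlgebraic_zero
  obtain ⟨m, hm⟩ := Int.eq_ofNat_of_zero_le (sub_nonneg.2 hlt.le)
  obtain rfl : e' = e + m := by omega
  have : p = Polynomial.X ^ m * q := by
    apply transcendental_iff_injective.1 hs
    rw [hp, zpow_add₀ hs0, mul_assoc] at hq
    simpa using mul_left_cancel₀ (zpow_ne_zero e hs0) hq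
  rw [this, Polynomial.mul_coeff_zero, Polynomial.coeff_X_pow, if_neg (by omega), zero_mul]

end HasLead

/-! ### Alternating normal forms. -/

/-- `h` is an alternating product `f ^ n₁ * a₁ * ⋯ * f ^ nᵣ * aᵣ` with `r ≥ 1`, all exponents
non-zero, all `aᵢ` in `A` and all but the last one outside `C`. -/
inductive IsAlternating {H : Type*} [Group H] (f : H) (A C : Subgroup H) : H → Prop
  | base (n : ℤ) (hn : n ≠ 0) (a : H) (ha : a ∈ A) : IsAlternating f A C (f ^ n * a)
  | step (n : ℤ) (hn : n ≠ 0) (a : H) (ha : a ∈ A) (haC : a ∉ C) (h : H)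
      (hh : IsAlternating f A C h) : IsAlternating f A C (f ^ n * a * h)

theorem IsAlternating.exists_of_closure_eq_top {H : Type*} [Group H] {f : H} {A C : Subgroup H}
    (hC : ∀ c ∈ C, Commute f c) (htop : Subgroup.closure (insert f (A : Set H)) = ⊤)
    (g : H) : g ∈ A ∨ ∃ a ∈ A, ∃ h, IsAlternating f A C h ∧ g = a * h := by
  have key : ∀ n : ℤ, n ≠ 0 → ∀ x, (x ∈ A ∨ ∃ a ∈ A, ∃ h, IsAlternating f A C h ∧ x = a * h) →
      (f ^ n * x ∈ A ∨ ∃ a ∈ A, ∃ h, IsAlternating f A C h ∧ f ^ n * x = a * h) := by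
    rintro n hn x (hx | ⟨a, ha, h, hh, rfl⟩)
    · exact .inr ⟨1, one_mem _, _, .base n hn x hx, by simp⟩
    -- An element of `C` slides past `f ^ n`, so `f ^ n` merges with the next power of `f`. If they
    -- cancel, the word gets shorter.
    by_cases haC : a ∈ C
    · have hcomm : f ^ n * a = a * f ^ n := ((hC a haC).zpow_left n).eq
      cases hh with
      | base m hm b hb =>
        by_cases hmn : n + m = 0
        · left
          rw [← mul_assoc, hcomm, mul_assoc, ← mul_assoc (f ^ n), ← zpow_add, hmn, zpow_zero,
            one_mul]
          exact mul_mem ha hb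
        · refine .inr ⟨a, ha, _, .base (n + m) hmn b hb, ?_⟩
          rw [← mul_assoc, hcomm, zpow_add]; group
      | step m hm b hb hbC h hh =>
        by_cases hmn : n + m = 0
        · refine .inr ⟨a * b, mul_mem ha hb, h, hh, ?_⟩
          have : f ^ n * (a * (f ^ m * b * h)) = a * f ^ (n + m) * b * h := by
            rw [← mul_assoc, hcomm, zpow_add]; group
          rw [this, hmn, zpow_zero, mul_one]
        · refine .inr ⟨a, ha, _, .step (n + m) hmn b hb hbC h hh, ?_⟩
          rw [← mul_assoc, hcomm, zpow_add]; group
    · exact .inr ⟨1, one_mem _, _, .step n hn a ha haC h hh, by simp [mul_assoc]⟩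
  have hg : g ∈ Subgroup.closure (insert f (A : Set H)) := htop ▸ Subgroup.mem_top g
  have hA : ∀ b ∈ A, ∀ x, (x ∈ A ∨ ∃ a ∈ A, ∃ h, IsAlternating f A C h ∧ x = a * h) →
      (b * x ∈ A ∨ ∃ a ∈ A, ∃ h, IsAlternating f A C h ∧ b * x = a * h) := by
    rintro b hb x (hx | ⟨a, ha, h, hh, rfl⟩)
    · exact .inl (mul_mem hb hx)
    · exact .inr ⟨b * a, mul_mem hb ha, h, hh, by simp [mul_assoc]⟩
  induction hg using Subgroup.closure_induction_left with
  | one => exact .inl (one_mem _)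
  | mul_left x hx y _ ih =>
    rcases hx with rfl | hx
    · simpa using key 1 one_ne_zero y ih
    · exact hA x hx y ih
  | inv_mul_cancel x hx y _ ih =>
    rcases hx with rfl | hx
    · simpa using key (-1) (by simp) y ih
    · exact hA x⁻¹ (inv_mem hx) y ih

/-! ### Condition (2) from a transcendental diagonal entry. -/

theorem HasLead.eq_of_ne_zero {k K : Type*} [CommRing k] [Field K] [Algebra k K] {s : K}
    (hs : Transcendental k s) {e e' : ℤ} {u : K} {c c' : k} (h : HasLead s e u c)
    (h' : HasLead s e' u c') (hc : c ≠ 0) (hc' : c' ≠ 0) : e = e' := by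
  rcases lt_trichotomy e e' with hlt | heq | hlt
  · exact absurd (h.eq_zero_of_lt hs h' hlt) hc
  · exact heq
  · exact absurd (h'.eq_zero_of_lt hs h hlt) hc'

theorem coe_diagInv {F : Type*} [Field F] {l : F} (hl : l ≠ 0) :
    (diagInv l hl : Matrix (Fin 2) (Fin 2) F) = !![l, 0; 0, l⁻¹] := rfl

theorem diagInv_zpow {F : Type*} [Field F] {l : F} (hl : l ≠ 0) (m : ℤ) :
    diagInv l hl ^ m = diagInv (l ^ m) (zpow_ne_zero m hl) := by
  let f : Fˣ →* GL (Fin 2) F :=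
    MonoidHom.mk' (fun u => diagInv u.1 u.ne_zero) fun a b => by
      ext i j
      fin_cases i <;> fin_cases j <;> simp [coe_diagInv, mul_comm]
  have h := map_zpow f (Units.mk0 l hl) m
  have h1 : f (Units.mk0 l hl) = diagInv l hl := rfl
  rw [← h1, ← h]
  ext i j
  simp [f, coe_diagInv]

section FreePair

variable {k F : Type*} [CommRing k] [IsDomain k] [Field F] [Algebra k F] {X : GL (Fin 2) F} {l : F}
  (hl : l ≠ 0) {c : ℤ → Fin 2 → Fin 2 → k}

/-- `m` is the last exponent of the diagonal matrix and `M` the sum of the absolute values of the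
inner ones. `M` and `m` are chosen before `s` and `ε`, so that the expansions in `l` and in `l⁻¹`
can be compared. -/
theorem hasLead_alternating (hc : ∀ n i j, algebraMap k F (c n i j) = (X ^ n) i j)
    (hc0 : ∀ n, n ≠ 0 → ∀ i j, c n i j ≠ 0) {h : FreeGroup (Fin 2)}
    (hh : IsAlternating (FreeGroup.of 0) (Subgroup.zpowers (FreeGroup.of 1)) ⊥ h) :
    ∃ M m : ℤ, 0 ≤ M ∧
      (M = 0 → ∃ n : ℤ, n ≠ 0 ∧ h = FreeGroup.of 0 ^ n * FreeGroup.of 1 ^ m) ∧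
      ∀ (s : F) (ε : ℤ), s ≠ 0 → (ε = 1 ∨ ε = -1) → (∀ z : ℤ, l ^ z = s ^ (ε * z)) →
        ∃ d : Fin 2 → k, (∀ j, d j ≠ 0) ∧
          ∀ j, HasLead s (ε * m - M) (FreeGroup.lift ![X, diagInv l hl] h j 0) (d j) := by
  have hX : ∀ (s : F) n i j, HasLead s 0 ((X ^ n) i j) (c n i j) := fun s n i j =>
    hc n i j ▸ HasLead.of_algebraMap (c n i j)
  induction hh with
  | base n hn a ha =>
    obtain ⟨m, rfl⟩ := ha
    refine ⟨0, m, le_rfl, fun _ => ⟨n, hn, rfl⟩, fun s ε hs _ hls => ⟨fun j => c n j 0,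
      fun j => hc0 n hn j 0, fun j => ?_⟩⟩
    have h1 := (hX s n j 0).mul hs (HasLead.zpow (k := k) hs (le_refl (ε * m)))
    simpa [Matrix.mul_apply, diagInv_zpow, coe_diagInv, hls m] using h1
  | step n hn a ha haC h hh ih =>
    obtain ⟨m, rfl⟩ := ha
    have hm : m ≠ 0 := by rintro rfl; simp at haC
    obtain ⟨M, m', hM, -, H⟩ := ih
    refine ⟨M + |m|, m', by positivity, fun h0 => ?_, fun s ε hs hε hls => ?_⟩
    · have := abs_pos.2 hm
      omega
    obtain ⟨d, hd, hlead⟩ := H s ε hs hε hls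
    -- Exactly one of the two diagonal entries has order `-|m|`, so a single term dominates and
    -- nothing cancels.
    have hεm : ε * m = |m| ∧ ε * m ≠ -|m| ∧ ε * -m = -|m| ∨
        ε * m = -|m| ∧ ε * -m ≠ -|m| ∧ ε * -m = |m| := by
      rcases hε with rfl | rfl <;> rcases abs_cases m with ⟨h, _⟩ | ⟨h, _⟩ <;> rw [h] <;> omega
    have hle : -|m| ≤ |m| := neg_le_self (abs_nonneg m)
    have e1 : -|m| ≤ ε * m := by rcases hεm with h | h <;> omega
    have e2 : -|m| ≤ ε * -m := by rcases hεm with h | h <;> omega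
    have key := fun j => HasLead.sum Finset.univ (s := s) (e := 0 + -|m| + (ε * m' - M))
      (u := ![(X ^ n) j 0 * s ^ (ε * m) * FreeGroup.lift ![X, diagInv l hl] h 0 0,
        (X ^ n) j 1 * s ^ (ε * -m) * FreeGroup.lift ![X, diagInv l hl] h 1 0])
      (c := ![c n j 0 * (if ε * m = -|m| then 1 else 0) * d 0,
        c n j 1 * (if ε * -m = -|m| then 1 else 0) * d 1]) (fun i => by
          fin_cases i
          · exact ((hX s n j 0).mul hs (HasLead.zpow hs e1)).mul hs (hlead 0)
          · exact ((hX s n j 1).mul hs (HasLead.zpow hs e2)).mul hs (hlead 1))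
    refine ⟨fun j => ∑ i, ![c n j 0 * (if ε * m = -|m| then 1 else 0) * d 0,
      c n j 1 * (if ε * -m = -|m| then 1 else 0) * d 1] i, fun j => ?_, fun j => ?_⟩
    rotate_left
    · convert! key j using 1
      · ring
      · simp only [map_mul, map_zpow, FreeGroup.lift_apply_of, Matrix.GeneralLinearGroup.coe_mul]
        simp [Matrix.mul_apply, diagInv_zpow, coe_diagInv, ← hls, Fin.sum_univ_two]
    · simp only [Fin.sum_univ_two]
      rcases hεm with ⟨_, h1, h2⟩ | ⟨h1, h2, _⟩
      · simp [h1, h2, hc0 n hn, hd]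
      · rw [if_pos h1, if_neg h2]
        simp [hc0 n hn, hd]

/-- Unless `w` is a power of the diagonal generator, its top left entry being 1 makes that of the
alternating factor a monomial in `l`, whose orders in `l` and `l⁻¹` are opposite. -/
theorem eq_one_of_lift_apply_eq_one (hlt : Transcendental k l)
    (hc : ∀ n i j, algebraMap k F (c n i j) = (X ^ n) i j)
    (hc0 : ∀ n, n ≠ 0 → ∀ i j, c n i j ≠ 0) (hX1 : ∀ n : ℤ, n ≠ 0 → (X ^ n) 0 0 ≠ 1)
    (w : FreeGroup (Fin 2)) (hw : FreeGroup.lift ![X, diagInv l hl] w 0 0 = 1) : w = 1 := by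
  have hlt' : Transcendental k l⁻¹ := fun h => hlt (by simpa using h.inv)
  have htop : Subgroup.closure (insert (FreeGroup.of (0 : Fin 2))
      (Subgroup.zpowers (FreeGroup.of (1 : Fin 2)) : Set (FreeGroup (Fin 2)))) = ⊤ := by
    rw [eq_top_iff, ← FreeGroup.closure_range_of, Subgroup.closure_le]
    rintro _ ⟨i, rfl⟩
    fin_cases i
    · exact Subgroup.subset_closure (.inl rfl)
    · exact Subgroup.subset_closure (.inr (Subgroup.mem_zpowers _))
  rcases IsAlternating.exists_of_closure_eq_top (C := ⊥)
    (by simp) htop w with ⟨m, rfl⟩ | ⟨_, ⟨m₀, rfl⟩, h, hh, rfl⟩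
  · have h1 : l ^ m = 1 := by simpa [diagInv_zpow, coe_diagInv] using hw
    have h2 := HasLead.zpow (k := k) hl (le_refl m)
    rw [h1] at h2
    have h3 := HasLead.of_algebraMap (s := l) (K := F) (1 : k)
    rw [map_one] at h3
    have := h2.eq_of_ne_zero hlt h3 (by simp) one_ne_zero
    simp [this]
  · obtain ⟨M, m, hM, hbase, H⟩ := hasLead_alternating hl hc hc0 hh
    have hw' : FreeGroup.lift ![X, diagInv l hl] h 0 0 = l ^ (-m₀) := by
      simp only [map_mul, map_zpow, FreeGroup.lift_apply_of,
        Matrix.GeneralLinearGroup.coe_mul] at hw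
      simp [Matrix.mul_apply, diagInv_zpow, coe_diagInv, Fin.sum_univ_two] at hw
      rw [zpow_neg]
      exact eq_inv_of_mul_eq_one_right hw
    obtain ⟨d, hd, h1⟩ := H l 1 hl (.inl rfl) (by simp)
    obtain ⟨d', hd', h2⟩ := H l⁻¹ (-1) (inv_ne_zero hl) (.inr rfl) (by simp)
    have h3 := HasLead.zpow (k := k) hl (le_refl (-m₀))
    have h4 := HasLead.zpow (k := k) (inv_ne_zero hl) (le_refl m₀)
    have e1 := (hw' ▸ h1 0).eq_of_ne_zero hlt h3 (hd 0) (by simp)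
    have hw'' : FreeGroup.lift ![X, diagInv l hl] h 0 0 = l⁻¹ ^ m₀ := by rw [hw']; simp
    have e2 := (hw'' ▸ h2 0).eq_of_ne_zero hlt' h4 (hd' 0) (by simp)
    -- `e1` and `e2` read `m - M = -m₀` and `-m - M = m₀`; adding them gives `M = 0`.
    obtain ⟨n, hn, rfl⟩ := hbase (by omega)
    obtain rfl : m₀ = -m := by omega
    -- Now `w` is a conjugate of a power of the first generator by a diagonal matrix, which
    -- preserves the top left entry.
    refine absurd ?_ (hX1 n hn)
    simp only [map_mul, map_zpow, FreeGroup.lift_apply_of, Matrix.cons_val_one, diagInv_zpow,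
      Matrix.cons_val_zero, Matrix.GeneralLinearGroup.coe_mul] at hw
    have hcancel : ∀ x : F, (l ^ m)⁻¹ * (x * l ^ m) = x := fun x => by
      rw [mul_comm x, inv_mul_cancel_left₀ (zpow_ne_zero m hl)]
    simpa [Matrix.mul_apply, coe_diagInv, Fin.sum_univ_two, hcancel] using hw

theorem condition2_of_transcendental (hlt : Transcendental k l)
    (hc : ∀ n i j, algebraMap k F (c n i j) = (X ^ n) i j)
    (hc0 : ∀ n, n ≠ 0 → ∀ i j, c n i j ≠ 0) (hX1 : ∀ n : ℤ, n ≠ 0 → (X ^ n) 0 0 ≠ 1) :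
    Condition2 X (diagInv l hl) := by
  have key := eq_one_of_lift_apply_eq_one hl hlt hc hc0 hX1
  refine ⟨(injective_iff_map_eq_one _).2 fun w hw => key w (by simp [hw]), fun M hM hM1 => ?_⟩
  have hle : Subgroup.closure {X, diagInv l hl} ≤ (FreeGroup.lift ![X, diagInv l hl]).range := by
    rw [Subgroup.closure_le]
    rintro _ (rfl | rfl)
    · exact ⟨FreeGroup.of 0, by simp⟩
    · exact ⟨FreeGroup.of 1, by simp⟩
  obtain ⟨w, rfl⟩ := hle hM
  rw [key w hM1, map_one]

end FreePair

/-! ### Degrees in powers of the explicit matrix. -/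

section PolynomialMatrix

open Polynomial

/-- The matrix with rows `(X ^ 2, X - 1)` and `(X + 1, 1)`, of determinant one. -/
noncomputable def polyMatrix (R : Type*) [CommRing R] : SL(2, R[X]) :=
  ⟨!![X ^ 2, X - 1; X + 1, 1], by rw [Matrix.det_fin_two_of]; ring⟩

theorem coe_polyMatrix (R : Type*) [CommRing R] :
    (polyMatrix R : Matrix (Fin 2) (Fin 2) R[X]) = !![X ^ 2, X - 1; X + 1, 1] := rfl

variable {R : Type*} [CommRing R] [Nontrivial R]

theorem polyMatrix_pow_isMonicOfDegree (m : ℕ) :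
    IsMonicOfDegree ((polyMatrix R ^ (m + 1)) 0 0) (2 * m + 2) ∧
    IsMonicOfDegree ((polyMatrix R ^ (m + 1)) 0 1) (2 * m + 1) ∧
    IsMonicOfDegree ((polyMatrix R ^ (m + 1)) 1 0) (2 * m + 1) ∧
    IsMonicOfDegree ((polyMatrix R ^ (m + 1)) 1 1) (2 * m) := by
  have hs : IsMonicOfDegree (X - 1 : R[X]) 1 := by simpa using isMonicOfDegree_X_sub_one (1 : R)
  have ha : IsMonicOfDegree (X + 1 : R[X]) 1 := by simpa using isMonicOfDegree_X_add_one (1 : R)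
  induction m with
  | zero =>
    simpa [coe_polyMatrix, isMonicOfDegree_X_pow, isMonicOfDegree_zero_iff] using And.intro hs ha
  | succ m ih =>
    obtain ⟨h00, h01, h10, h11⟩ := ih
    rw [pow_succ]
    simp only [Matrix.SpecialLinearGroup.coe_mul, Matrix.mul_apply, Fin.sum_univ_two]
    simp only [coe_polyMatrix, Matrix.of_apply, Matrix.cons_val_zero, Matrix.cons_val_one,
      Matrix.cons_val', Matrix.cons_val_fin_one, mul_one]
    refine ⟨(h00.mul (isMonicOfDegree_X_pow R 2)).add_right ?_, (h00.mul hs).add_right ?_,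
      (h10.mul (isMonicOfDegree_X_pow R 2)).add_right ?_, (h10.mul hs).add_right ?_⟩
    · rw [(h01.mul ha).natDegree_eq]; omega
    · rw [h01.natDegree_eq]; omega
    · rw [(h11.mul ha).natDegree_eq]; omega
    · rw [h11.natDegree_eq]; omega

/-- Squaring is needed because the bottom right entry of `polyMatrix` itself is the constant 1. -/
theorem natDegree_polyMatrix_sq_pow_pos (n : ℕ) (hn : n ≠ 0) (i j : Fin 2) :
    0 < (((polyMatrix R ^ 2) ^ n) i j).natDegree := by
  obtain ⟨m, rfl⟩ := Nat.exists_eq_succ_of_ne_zero hn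
  rw [← pow_mul, show 2 * (m + 1) = (2 * m + 1) + 1 by ring]
  obtain ⟨h00, h01, h10, h11⟩ := polyMatrix_pow_isMonicOfDegree (R := R) (2 * m + 1)
  fin_cases i <;> fin_cases j
  exacts [h00.natDegree_eq ▸ by omega, h01.natDegree_eq ▸ by omega, h10.natDegree_eq ▸ by omega,
    h11.natDegree_eq ▸ by omega]

theorem natDegree_polyMatrix_sq_zpow_pos (n : ℤ) (hn : n ≠ 0) (i j : Fin 2) :
    0 < (((polyMatrix R ^ 2) ^ n) i j).natDegree := by
  obtain ⟨m, rfl | rfl⟩ := n.eq_nat_or_neg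
  · rw [zpow_natCast]
    exact natDegree_polyMatrix_sq_pow_pos m (by simpa using hn) i j
  · have h := natDegree_polyMatrix_sq_pow_pos (R := R) m (by simpa using hn)
    -- In determinant one the inverse only permutes the entries and changes signs.
    rw [zpow_neg, zpow_natCast, Matrix.SpecialLinearGroup.coe_inv, Matrix.adjugate_fin_two]
    fin_cases i <;> fin_cases j
    exacts [h 1 1, by simpa [-Matrix.SpecialLinearGroup.coe_pow] using h 0 1,
      by simpa [-Matrix.SpecialLinearGroup.coe_pow] using h 1 0, h 0 0]

end PolynomialMatrix

theorem explicit_det_ne_zero {F : Type*} [Field F] (t : F) :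
    (t ^ 4 + t ^ 2 - 1) * t ^ 2 - (t - 1) * (t ^ 2 + 1) * ((t + 1) * (t ^ 2 + 1)) ≠ 0 := by
  rw [show (t ^ 4 + t ^ 2 - 1) * t ^ 2 - (t - 1) * (t ^ 2 + 1) * ((t + 1) * (t ^ 2 + 1)) = 1 by
    ring]
  exact one_ne_zero

theorem explicit_conditions {k₀ F : Type*} [Field k₀] [Field F] [Algebra k₀ F] {t l : F}
    (h : AlgebraicIndependent k₀ ![t, l]) (hl : l ≠ 0)
    (hdet : (t ^ 4 + t ^ 2 - 1) * t ^ 2 - (t - 1) * (t ^ 2 + 1) * ((t + 1) * (t ^ 2 + 1)) ≠ 0) :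
    Condition1 (gl2 (t ^ 4 + t ^ 2 - 1) ((t - 1) * (t ^ 2 + 1)) ((t + 1) * (t ^ 2 + 1)) (t ^ 2)
      hdet) ∧
    Condition2 (gl2 (t ^ 4 + t ^ 2 - 1) ((t - 1) * (t ^ 2 + 1)) ((t + 1) * (t ^ 2 + 1)) (t ^ 2)
      hdet) (diagInv l hl) := by
  set Z := gl2 (t ^ 4 + t ^ 2 - 1) ((t - 1) * (t ^ 2 + 1)) ((t + 1) * (t ^ 2 + 1)) (t ^ 2) hdet
  have ht : Transcendental k₀ t := h.transcendental 0
  have hinj := transcendental_iff_injective.1 ht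
  let φ : SL(2, Polynomial k₀) →* GL (Fin 2) F := Matrix.SpecialLinearGroup.toGL.comp
    (Matrix.SpecialLinearGroup.map (Polynomial.aeval t : Polynomial k₀ →ₐ[k₀] F).toRingHom)
  have hZ : φ (polyMatrix k₀ ^ 2) = Z := by
    ext i j
    have : ∀ i j, φ (polyMatrix k₀ ^ 2) i j = Polynomial.aeval t ((polyMatrix k₀ ^ 2) i j) :=
      fun _ _ => rfl
    rw [this]
    fin_cases i <;> fin_cases j <;>
      simp [coe_polyMatrix, Z, gl2, Matrix.GeneralLinearGroup.mkOfDetNeZero, pow_two,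
        Matrix.mul_apply, Fin.sum_univ_two] <;> ring
  have hpow : ∀ (n : ℤ) i j,
      (Z ^ n) i j = Polynomial.aeval t (((polyMatrix k₀ ^ 2) ^ n) i j) := fun n i j => by
    rw [← hZ, ← map_zpow]; rfl
  have hne : ∀ (a : k₀) (n : ℤ), n ≠ 0 → ∀ i j, (Z ^ n) i j ≠ algebraMap k₀ F a := by
    intro a n hn i j he
    rw [hpow, ← Polynomial.aeval_C t a] at he
    have := natDegree_polyMatrix_sq_zpow_pos (R := k₀) n hn i j
    rw [hinj he, Polynomial.natDegree_C] at this
    exact lt_irrefl _ this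
  have hne0 : ∀ n : ℤ, n ≠ 0 → ∀ i j, (Z ^ n) i j ≠ 0 := by simpa using hne 0
  refine ⟨fun n hn => ⟨hne0 n hn 0 1, hne0 n hn 1 0⟩, ?_⟩
  -- The coefficient ring for expansions in `l` is `k₀[t]`, which contains every entry of `Z ^ n`.
  have hlt : Transcendental (Algebra.adjoin k₀ (![t, l] '' {0})) l :=
    h.transcendental_adjoin (i := 1) (s := {0}) (by simp)
  have hmem : ∀ (n : ℤ) i j, (Z ^ n) i j ∈ Algebra.adjoin k₀ (![t, l] '' {0}) := fun n i j => by
    rw [hpow]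
    simp
  refine condition2_of_transcendental hl hlt (c := fun n i j => ⟨(Z ^ n) i j, hmem n i j⟩)
    (fun _ _ _ => rfl) (fun n hn i j he => hne0 n hn i j (congrArg Subtype.val he))
    (fun n hn => by simpa using hne 1 n hn 0 0)

theorem admissible_of_algebraicIndependent {k₀ F : Type*} [Field k₀] [Field F] [Algebra k₀ F]
    {t l : F} (h : AlgebraicIndependent k₀ ![t, l]) :
    AdmissibleQuadruple
        !![t ^ 4 + t ^ 2 - 1, (t - 1) * (t ^ 2 + 1), 0;
           (t + 1) * (t ^ 2 + 1), t ^ 2, 0;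
           0, 0, 1]
        !![l, 0, 0; 0, l, 0; 0, 0, l⁻¹]
        !![l, 0, 0; 0, l⁻¹, 0; 0, 0, l]
        !![t ^ 4 + t ^ 2 - 1, 0, (t - 1) * (t ^ 2 + 1);
           0, 1, 0;
           (t + 1) * (t ^ 2 + 1), 0, t ^ 2] := by
  have hl : l ≠ 0 := h.ne_zero 1
  exact ⟨_, _, _, _, _, _, _, _, _, explicit_det_ne_zero t,
    explicit_det_ne_zero t, hl, rfl, rfl, rfl, rfl,
    explicit_conditions h hl _⟩

/-! ### The deformed representation of the path group. -/

namespace RAAG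

variable {V : Type*} {Γ : SimpleGraph V}

/-- The generator of a right angled Artin group at a vertex. -/
def of (v : V) : RAAG Γ := PresentedGroup.of v

/-- The homomorphism given by images of the vertices that commute along the edges. -/
def lift {G : Type*} [Group G] (f : V → G) (hf : ∀ v w, Γ.Adj v w → Commute (f v) (f w)) :
    RAAG Γ →* G :=
  PresentedGroup.toGroup (f := f) (by
    rintro _ ⟨v, w, h, rfl⟩
    simp [(hf v w h).eq])

@[simp]
theorem lift_of {G : Type*} [Group G] (f : V → G)
    (hf : ∀ v w, Γ.Adj v w → Commute (f v) (f w)) (v : V) : lift f hf (of v) = f v :=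
  PresentedGroup.toGroup.of _

theorem commute_of {v w : V} (h : Γ.Adj v w) : Commute (of v : RAAG Γ) (of w) := by
  have h1 : (PresentedGroup.mk {r : FreeGroup V | ∃ v w : V, Γ.Adj v w ∧
      r = FreeGroup.of v * FreeGroup.of w * (FreeGroup.of v)⁻¹ * (FreeGroup.of w)⁻¹})
      (FreeGroup.of v * FreeGroup.of w * (FreeGroup.of v)⁻¹ * (FreeGroup.of w)⁻¹) = 1 :=
    PresentedGroup.one_of_mem ⟨v, w, h, rfl⟩
  rw [map_mul, map_mul, map_mul, map_inv, map_inv, mul_inv_eq_one, mul_inv_eq_iff_eq_mul] at h1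
  exact h1

theorem closure_range_of : Subgroup.closure (Set.range (of : V → RAAG Γ)) = ⊤ :=
  PresentedGroup.closure_range_of _

end RAAG

/-- The conjugate of the block sum of a `2 × 2` and a `1 × 1` block by the elementary matrix with
an off-diagonal entry in the lower left corner. -/
def shearedBlock (F : Type*) [CommRing F] :
    Matrix (Fin 2) (Fin 2) F × F →* Matrix (Fin 3) (Fin 3) F where
  toFun M := !![M.1 0 0, M.1 0 1, 0; M.1 1 0, M.1 1 1, 0; M.2 - M.1 0 0, -M.1 0 1, M.2]
  map_one' := by ext i j; fin_cases i <;> fin_cases j <;> simp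
  map_mul' M N := by
    ext i j
    fin_cases i <;> fin_cases j <;>
      simp [Matrix.mul_apply, Fin.sum_univ_three, Fin.sum_univ_two] <;> ring

/-- The embedding of `2 × 2` matrices in the first and third coordinates, followed by conjugation
with the diagonal matrix with entries `s⁻¹, 1, 1`. -/
def scaledCorner {K : Type*} [Field K] (s : Kˣ) :
    Matrix (Fin 2) (Fin 2) K →* Matrix (Fin 3) (Fin 3) K where
  toFun M := !![M 0 0, 0, (s : K)⁻¹ * M 0 1; 0, 1, 0; s * M 1 0, 0, M 1 1]
  map_one' := by ext i j; fin_cases i <;> fin_cases j <;> simp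
  map_mul' M N := by
    ext i j
    fin_cases i <;> fin_cases j <;>
      simp [Matrix.mul_apply, Fin.sum_univ_three, Fin.sum_univ_two] <;> field_simp

theorem HasLead.of_lt {k K : Type*} [CommRing k] [Field K] [Algebra k K] {s : K} (hs : s ≠ 0)
    {e e' : ℤ} {u : K} {c : k} (h : HasLead s e u c) (hlt : e' < e) : HasLead s e' u (0 : k) := by
  have := (HasLead.zpow (k := k) hs (show e' - e ≤ 0 by omega)).mul hs h
  simpa [show ¬ 0 = e' - e by omega] using this

section PathRAAG

variable {F K : Type*} [Field F] [Field K] [Algebra F K]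

/-- The block part of the representation, defined on pairs of blocks. -/
def blockRep (F K : Type*) [Field F] [Field K] [Algebra F K] :
    GL (Fin 2) F × Fˣ →* GL (Fin 3) K :=
  ((Matrix.GeneralLinearGroup.map (algebraMap F K)).comp (Units.map (shearedBlock F))).comp
    MulEquiv.prodUnits.symm.toMonoidHom

theorem blockRep_apply (M : GL (Fin 2) F × Fˣ) (i j : Fin 3) :
    blockRep F K M i j = algebraMap F K (shearedBlock F (M.1, M.2) i j) := rfl

/-- The corner part of the representation. -/
def cornerRep (F : Type*) {K : Type*} [Field F] [Field K] [Algebra F K] (s : Kˣ) :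
    GL (Fin 2) F →* GL (Fin 3) K :=
  (Units.map (scaledCorner s)).comp (Matrix.GeneralLinearGroup.map (algebraMap F K))

theorem coe_cornerRep (s : Kˣ) (M : GL (Fin 2) F) :
    (cornerRep F s M : Matrix (Fin 3) (Fin 3) K) = !![algebraMap F K (M 0 0), 0,
      (s : K)⁻¹ * algebraMap F K (M 0 1); 0, 1, 0; s * algebraMap F K (M 1 0), 0,
      algebraMap F K (M 1 1)] := rfl

/-- The pair of blocks for the generator `Q`. -/
def centralPair (l : Fˣ) : GL (Fin 2) F × Fˣ := (Matrix.GeneralLinearGroup.scalar (Fin 2) l, l⁻¹)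

/-- The third row of the sheared block has no off-diagonal entries here: the block is `diag(l, l⁻¹,
l)`, scalar on the coordinates where the corner acts. -/
theorem commute_blockRep_cornerRep (l : Fˣ) (s : Kˣ) (Z : GL (Fin 2) F) :
    Commute (blockRep F K (diagInv l.1 l.ne_zero, l)) (cornerRep F s Z) := by
  ext i j
  fin_cases i <;> fin_cases j <;>
    simp [Matrix.mul_apply, Fin.sum_univ_three, blockRep_apply, coe_cornerRep, shearedBlock,
      coe_diagInv] <;> ring

/-- The representation of the path group built from an admissible quadruple. -/
def pathRep (X Z : GL (Fin 2) F) (l : Fˣ) (s : Kˣ) : PathRAAG →* GL (Fin 3) K :=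
  RAAG.lift ![blockRep F K (X, 1), blockRep F K (centralPair l),
    blockRep F K (diagInv l.1 l.ne_zero, l), cornerRep F s Z] (by
      have hc : ∀ M, Commute (centralPair l) M := fun M => Prod.ext
        (Matrix.GeneralLinearGroup.scalar_commute _ _) (mul_comm _ _)
      have h01 : Commute (blockRep F K (X, 1)) (blockRep F K (centralPair l)) :=
        ((hc _).map (blockRep F K)).symm
      have h12 := (hc (diagInv l.1 l.ne_zero, l)).map (blockRep F K)
      have h23 := commute_blockRep_cornerRep l s Z
      intro v w hvw
      rw [SimpleGraph.pathGraph_adj] at hvw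
      fin_cases v <;> fin_cases w <;> simp at hvw
      exacts [h01, h01.symm, h12, h12.symm, h23, h23.symm])

end PathRAAG

/-! ### Faithfulness. -/

section Faithful

variable {F K : Type*} [Field F] [Field K] [Algebra F K]

/-- The subgroup of the path group generated by the first three vertices, parametrized by the
product of a free group and an infinite cyclic group. -/
def starHom : FreeGroup (Fin 2) × Multiplicative ℤ →* PathRAAG :=
  (FreeGroup.lift ![RAAG.of 0, RAAG.of 2]).noncommCoprod (zpowersHom PathRAAG (RAAG.of 1)) (by
    have h0 : Commute (RAAG.of 0 : PathRAAG) (RAAG.of 1) :=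
      RAAG.commute_of (by simp [SimpleGraph.pathGraph_adj])
    have h2 : Commute (RAAG.of 2 : PathRAAG) (RAAG.of 1) :=
      RAAG.commute_of (by simp [SimpleGraph.pathGraph_adj])
    intro w n
    have hle : (FreeGroup.lift ![(RAAG.of 0 : PathRAAG), RAAG.of 2]).range ≤
        Subgroup.centralizer {RAAG.of 1} := by
      refine FreeGroup.range_lift_le ?_
      rintro _ ⟨i, rfl⟩
      rw [SetLike.mem_coe, Subgroup.mem_centralizer_singleton_iff]
      fin_cases i
      exacts [h0.eq, h2.eq]
    have hw : Commute (FreeGroup.lift ![(RAAG.of 0 : PathRAAG), RAAG.of 2] w) (RAAG.of 1) :=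
      Subgroup.mem_centralizer_singleton_iff.1 (hle ⟨w, rfl⟩)
    exact hw.zpow_right n.toAdd)

theorem starHom_apply (w : FreeGroup (Fin 2)) (n : Multiplicative ℤ) :
    starHom (w, n) = FreeGroup.lift ![RAAG.of 0, RAAG.of 2] w * RAAG.of 1 ^ n.toAdd := rfl

/-- The pair of blocks of an element of the subgroup generated by the first three vertices. -/
def starPair (X : GL (Fin 2) F) (l : Fˣ) (w : FreeGroup (Fin 2)) (n : ℤ) : GL (Fin 2) F × Fˣ :=
  FreeGroup.lift ![(X, 1), (diagInv l.1 l.ne_zero, l)] w * centralPair l ^ n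

theorem pathRep_starHom (X Z : GL (Fin 2) F) (l : Fˣ) (s : Kˣ) (w : FreeGroup (Fin 2))
    (n : Multiplicative ℤ) :
    pathRep X Z l s (starHom (w, n)) = blockRep F K (starPair X l w n.toAdd) := by
  rw [starHom_apply, starPair, map_mul, map_mul, map_zpow, map_zpow]
  congr 1
  · have : (pathRep X Z l s).comp (FreeGroup.lift ![RAAG.of 0, RAAG.of 2]) =
        (blockRep F K).comp (FreeGroup.lift ![(X, 1), (diagInv l.1 l.ne_zero, l)]) := by
      ext i : 1
      fin_cases i <;> simp [pathRep]
    exact DFunLike.congr_fun this w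
  · simp [pathRep]

/-- This turns condition (2) into the non-vanishing needed between two powers of `RAAG.of 3`: the
(2,0) entry is the difference of the scalar block and the top left entry. -/
theorem starHom_mem_zpowers {X : GL (Fin 2) F} {l : Fˣ} (h2 : Condition2 X (diagInv l.1 l.ne_zero))
    (w : FreeGroup (Fin 2)) (n : Multiplicative ℤ)
    (h : shearedBlock F ((starPair X l w n.toAdd).1, (starPair X l w n.toAdd).2) 2 0 = 0) :
    starHom (w, n) ∈ Subgroup.zpowers (RAAG.of 2 : PathRAAG) := by
  obtain ⟨hinj, htriv⟩ := h2
  have h1 : (FreeGroup.lift ![(X, (1 : Fˣ)), (diagInv l.1 l.ne_zero, l)] w).1 =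
      FreeGroup.lift ![X, diagInv l.1 l.ne_zero] w := by
    have : (MonoidHom.fst _ _).comp (FreeGroup.lift ![(X, (1 : Fˣ)), (diagInv l.1 l.ne_zero, l)]) =
        FreeGroup.lift ![X, diagInv l.1 l.ne_zero] := by
      ext i : 1
      fin_cases i <;> simp
    exact DFunLike.congr_fun this w
  have hm : (FreeGroup.lift ![(X, (1 : Fˣ)), (diagInv l.1 l.ne_zero, l)] w).2 =
      FreeGroup.lift ![1, l] w := by
    have : (MonoidHom.snd _ _).comp (FreeGroup.lift ![(X, (1 : Fˣ)), (diagInv l.1 l.ne_zero, l)]) =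
        FreeGroup.lift ![1, l] := by
      ext i : 1
      fin_cases i <;> simp
    exact DFunLike.congr_fun this w
  -- The first generator has scalar block 1, so the scalar block of `w` is a power of `l`.
  obtain ⟨m, hm'⟩ : FreeGroup.lift ![1, l] w ∈ Subgroup.zpowers l := by
    refine FreeGroup.range_lift_le ?_ ⟨w, rfl⟩
    rintro _ ⟨i, rfl⟩
    fin_cases i
    exacts [one_mem _, Subgroup.mem_zpowers l]
  dsimp at hm'
  obtain ⟨n, rfl⟩ := Multiplicative.ofAdd.surjective n
  have hl := l.ne_zero
  have key : FreeGroup.lift ![X, diagInv l.1 l.ne_zero] w 0 0 = (l : F) ^ (m - 2 * n) := by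
    have h00 : shearedBlock F ((starPair X l w n).1, (starPair X l w n).2) 2 0 =
        (l : F) ^ (m - n) - FreeGroup.lift ![X, diagInv l.1 l.ne_zero] w 0 0 * (l : F) ^ n := by
      have hsc : ∀ (M : GL (Fin 2) F) (u : Fˣ),
          (M * Matrix.GeneralLinearGroup.scalar (Fin 2) u) 0 0 = M 0 0 * u := fun M u => by
        simp [Matrix.mul_apply, Fin.sum_univ_two]
      simp only [starPair, Prod.fst_mul, Prod.snd_mul, h1, hm, ← hm', centralPair, Prod.pow_mk,
        ← map_zpow, shearedBlock, MonoidHom.coe_mk, OneHom.coe_mk, hsc]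
      simp [zpow_sub₀ hl, div_eq_mul_inv]
    rw [toAdd_ofAdd, h00, sub_eq_zero] at h
    rw [show m - 2 * n = (m - n) - n by ring, zpow_sub₀ hl, h, mul_div_cancel_right₀ _
      (zpow_ne_zero n hl)]
  -- By `key`, this exponent normalises the top left entry to 1.
  have hw : w * FreeGroup.of 1 ^ (2 * n - m) = 1 := by
    apply hinj
    rw [map_one]
    apply htriv
    · have : (FreeGroup.lift ![X, diagInv l.1 l.ne_zero]).range ≤
          Subgroup.closure {X, diagInv l.1 l.ne_zero} := by
        refine FreeGroup.range_lift_le ?_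
        rintro _ ⟨i, rfl⟩
        apply Subgroup.subset_closure
        fin_cases i <;> simp
      exact this ⟨_, rfl⟩
    · simp only [map_mul, map_zpow, FreeGroup.lift_apply_of, Matrix.cons_val_one, diagInv_zpow,
        Matrix.cons_val_zero, Matrix.GeneralLinearGroup.coe_mul]
      simp [Matrix.mul_apply, Fin.sum_univ_two, coe_diagInv, key, ← zpow_add₀ hl]
  obtain rfl := eq_inv_of_mul_eq_one_left hw
  rw [← zpow_neg] at hm'
  -- Now `w` is a power of `FreeGroup.of 1`. Comparing its scalar block with `l ^ m` gives `l ^ (2 *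
  -- n) = 1`, while freeness gives `l` infinite order.
  have hn : n = 0 := by
    have h3 : l ^ m = l ^ (-(2 * n - m)) := by simpa using hm'
    have h4 : (l : F) ^ (2 * n) = 1 := by
      have h5 := congrArg (Units.val) h3
      push_cast at h5
      rw [show 2 * n = m - (-(2 * n - m)) by ring, zpow_sub₀ hl, h5, div_self (zpow_ne_zero _ hl)]
    have h5 : (FreeGroup.of (1 : Fin 2)) ^ (2 * n) = 1 := by
      apply hinj
      ext i j
      fin_cases i <;> fin_cases j <;>
        simp [diagInv_zpow, coe_diagInv, h4]
    have h6 := congrArg (FreeGroup.lift fun _ : Fin 2 => Multiplicative.ofAdd (1 : ℤ)) h5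
    simp only [map_zpow, FreeGroup.lift_apply_of, map_one, ← ofAdd_zsmul] at h6
    simpa using h6
  subst hn
  exact ⟨m, by simp [starHom_apply]⟩

end Faithful

section Injective

variable {F K : Type*} [Field F] [Field K] [Algebra F K]

theorem hasLead_cornerRep (s : Kˣ) (M : GL (Fin 2) F) (i j : Fin 3) :
    HasLead (s : K) (-1) (cornerRep F s M i j)
      ((!![0, 0, M 0 1; 0, 0, 0; 0, 0, 0] : Matrix (Fin 3) (Fin 3) F) i j) := by
  have hs := s.ne_zero
  have h0 : ∀ c : F, HasLead (s : K) (-1) (algebraMap F K c) (0 : F) := fun c =>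
    (HasLead.of_algebraMap c).of_lt hs (by norm_num)
  have h1 : ∀ c : F, HasLead (s : K) (-1) ((s : K)⁻¹ * algebraMap F K c) c := fun c => by
    simpa using (HasLead.zpow (k := F) hs (le_refl (-1))).mul hs (HasLead.of_algebraMap c)
  have h2 : ∀ c : F, HasLead (s : K) (-1) ((s : K) * algebraMap F K c) (0 : F) := fun c => by
    simpa using (HasLead.zpow (k := F) hs (show (-1 : ℤ) ≤ 1 by norm_num)).mul hs
      (HasLead.of_algebraMap c)
  have hz := h0 0
  have ho := h0 1
  rw [map_zero] at hz
  rw [map_one] at ho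
  rw [coe_cornerRep]
  fin_cases i <;> fin_cases j
  exacts [h0 _, hz, h1 _, hz, ho, hz, h2 _, hz, h0 _]

theorem hasLead_blockRep (s : K) (M : GL (Fin 2) F × Fˣ) :
    ∀ i j, HasLead s 0 (blockRep F K M i j) (shearedBlock F (M.1, M.2) i j) :=
  fun i j => HasLead.of_algebraMap (s := s) (shearedBlock F (M.1, M.2) i j)

/-- The lowest coefficient matrix is supported on its first row. Each further factor multiplies that
row by `(Z ^ n) 0 1` times the (2,0) entry of the sheared block. -/
theorem hasLead_pathRep_alternating {X Z : GL (Fin 2) F} {l : Fˣ} (s : Kˣ) (h1 : Condition1 Z)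
    (h2 : Condition2 X (diagInv l.1 l.ne_zero)) {h : PathRAAG}
    (hh : IsAlternating (RAAG.of 3) starHom.range (Subgroup.zpowers (RAAG.of 2)) h) :
    ∃ (e : ℤ) (C : Matrix (Fin 3) (Fin 3) F), e < 0 ∧
      (∀ i j, HasLead (s : K) e (pathRep X Z l s h i j) (C i j)) ∧
      (∃ j, C 0 j ≠ 0) ∧ ∀ j, C 1 j = 0 ∧ C 2 j = 0 := by
  have hlead : ∀ (n : ℤ) w m, ∀ i j, HasLead (s : K) (-1)
      (pathRep X Z l s (RAAG.of 3 ^ n * starHom (w, m)) i j)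
      (((!![0, 0, (Z ^ n) 0 1; 0, 0, 0; 0, 0, 0] : Matrix (Fin 3) (Fin 3) F) *
        shearedBlock F ((starPair X l w m.toAdd).1, (starPair X l w m.toAdd).2)) i j) := by
    intro n w m
    have h3 : pathRep X Z l s (RAAG.of 3) = cornerRep F s Z := by simp [pathRep]
    rw [map_mul, map_zpow, h3, ← map_zpow, pathRep_starHom]
    exact HasLead.matrix_mul s.ne_zero (hasLead_cornerRep s (Z ^ n))
      (hasLead_blockRep (s : K) _)
  induction hh with
  | base n hn a ha =>
    obtain ⟨⟨w, m⟩, rfl⟩ := ha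
    refine ⟨-1, _, by norm_num, hlead n w m, ?_, fun j => ?_⟩
    -- The first row is a nonzero multiple of the last row of an invertible matrix.
    · by_contra! hrow
      have hdet : IsUnit (shearedBlock F ((starPair X l w m.toAdd).1,
          (starPair X l w m.toAdd).2)).det :=
        (Matrix.isUnit_iff_isUnit_det _).1
          (Units.map (shearedBlock F) (MulEquiv.prodUnits.symm (starPair X l w m.toAdd))).isUnit
      refine hdet.ne_zero (Matrix.det_eq_zero_of_row_eq_zero 2 fun j => ?_)
      have := hrow j
      simp only [Matrix.mul_apply, Fin.sum_univ_three] at this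
      simpa [-Matrix.coe_units_zpow, (h1 n hn).1] using this
    · simp [Matrix.mul_apply, Fin.sum_univ_three]
  | step n hn a ha haC h hh ih =>
    obtain ⟨⟨w, m⟩, rfl⟩ := ha
    obtain ⟨e, C, he, hC, ⟨j, hj⟩, h0⟩ := ih
    refine ⟨-1 + e, !![0, 0, (Z ^ n) 0 1; 0, 0, 0; 0, 0, 0] *
      shearedBlock F ((starPair X l w m.toAdd).1, (starPair X l w m.toAdd).2) * C, by omega, ?_,
      ⟨j, ?_⟩, fun j => ?_⟩
    · rw [map_mul]
      exact HasLead.matrix_mul s.ne_zero (hlead n w m) hC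
    · have h20 := mt (starHom_mem_zpowers h2 w m) haC
      simp only [Matrix.mul_apply, Fin.sum_univ_three, h0]
      simpa [-Matrix.coe_units_zpow, (h1 n hn).1, hj] using h20
    · simp only [Matrix.mul_apply, Fin.sum_univ_three]
      simp

theorem pathRep_injective {X Z : GL (Fin 2) F} {l : Fˣ} {s : Kˣ} (hs : Transcendental F (s : K))
    (h1 : Condition1 Z) (h2 : Condition2 X (diagInv l.1 l.ne_zero)) :
    Function.Injective (pathRep X Z l s) := by
  rw [injective_iff_map_eq_one]
  intro g hg
  have htop : Subgroup.closure (insert (RAAG.of 3 : PathRAAG) (starHom.range : Set PathRAAG)) =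
      ⊤ := by
    rw [eq_top_iff, ← RAAG.closure_range_of, Subgroup.closure_le]
    rintro _ ⟨i, rfl⟩
    apply Subgroup.subset_closure
    fin_cases i
    · exact .inr ⟨(FreeGroup.of 0, 1), by simp [starHom_apply]⟩
    · exact .inr ⟨(1, Multiplicative.ofAdd 1), by simp [starHom_apply]⟩
    · exact .inr ⟨(FreeGroup.of 1, 1), by simp [starHom_apply]⟩
    · exact .inl rfl
  have h32 : Commute (RAAG.of 3 : PathRAAG) (RAAG.of 2) :=
    RAAG.commute_of (by simp [SimpleGraph.pathGraph_adj])
  rcases IsAlternating.exists_of_closure_eq_top (C := Subgroup.zpowers (RAAG.of 2))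
    (by rintro _ ⟨n, rfl⟩; exact h32.zpow_right n) htop g with
    ⟨⟨w, n⟩, rfl⟩ | ⟨_, ⟨⟨w, n⟩, rfl⟩, h, hh, rfl⟩
  · have hinj := (algebraMap F K).injective
    -- The identity has zero (2,0) entry, so an element of the star subgroup in the kernel is a
    -- power of `RAAG.of 2`.
    obtain ⟨m, hm⟩ := starHom_mem_zpowers h2 w n (hinj (by
      rw [pathRep_starHom] at hg
      rw [← blockRep_apply (K := K), hg]
      simp))
    dsimp at hm
    rw [← hm] at hg ⊢
    have h00 : (l : F) ^ m = 1 := by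
      have h3 : pathRep X Z l s (RAAG.of 2) = blockRep F K (diagInv l.1 l.ne_zero, l) := by
        simp [pathRep]
      rw [map_zpow, h3, ← map_zpow, Prod.pow_mk] at hg
      have := congrArg (fun M : GL (Fin 3) K => M 2 2) hg
      simp only [blockRep_apply] at this
      apply hinj
      simpa [shearedBlock] using this
    have h5 : FreeGroup.of (1 : Fin 2) ^ m = 1 := by
      apply h2.1
      ext i j
      fin_cases i <;> fin_cases j <;> simp [diagInv_zpow, coe_diagInv, h00]
    have h6 := congrArg (FreeGroup.lift fun _ : Fin 2 => Multiplicative.ofAdd (1 : ℤ)) h5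
    simp only [map_zpow, FreeGroup.lift_apply_of, map_one, ← ofAdd_zsmul] at h6
    have hm0 : m = 0 := by simpa using h6
    rw [hm0, zpow_zero]
  · obtain ⟨e, C, he, hC, ⟨j, hj⟩, -⟩ := hasLead_pathRep_alternating s h1 h2 hh
    rw [map_mul, pathRep_starHom, mul_eq_one_iff_inv_eq, ← map_inv] at hg
    have h3 := hC 0 j
    rw [← hg] at h3
    -- The image of `h` would have entries in the base field, hence order at least 0, against `e <
    -- 0`.
    exact absurd (h3.eq_zero_of_lt hs (hasLead_blockRep (s : K) _ 0 j) he) hj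

end Injective

/-! ### The lower bound on the dimension. -/

/-- Sending the two vertices to non-commuting transpositions of `S₃` and all others to 1 respects
the relations. -/
theorem RAAG.not_commute_of {V : Type*} [DecidableEq V] {Γ : SimpleGraph V} {v w : V} (hvw : v ≠ w)
    (h : ¬ Γ.Adj v w) : ¬ Commute (RAAG.of v : RAAG Γ) (RAAG.of w) := by
  let f : V → Equiv.Perm (Fin 3) := fun x =>
    if x = v then Equiv.swap 0 1 else if x = w then Equiv.swap 1 2 else 1
  have hf : ∀ x y, Γ.Adj x y → Commute (f x) (f y) := by
    intro x y hxy
    by_cases hxv : x = v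
    · have h1 : y ≠ v := fun e => hxy.ne (hxv.trans e.symm)
      have h2 : y ≠ w := fun e => h (hxv ▸ e ▸ hxy)
      simp [f, h1, h2]
    by_cases hxw : x = w
    · have h1 : y ≠ w := fun e => hxy.ne (hxw.trans e.symm)
      have h2 : y ≠ v := fun e => h (hxw ▸ e ▸ hxy.symm)
      simp [f, h1, h2]
    simp [f, hxv, hxw]
  intro hc
  have h1 := hc.map (RAAG.lift f hf)
  rw [RAAG.lift_of, RAAG.lift_of] at h1
  simp only [f, if_true, if_neg hvw.symm] at h1
  exact absurd h1.eq (by decide)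

/-- A nonscalar `M` has centraliser spanned by `I` and `M`, which is commutative; a scalar `M`
commutes with every `N`. -/
theorem Matrix.mul_comm_or_mul_comm_of_fin_two {F : Type*} [Field F]
    {M A B : Matrix (Fin 2) (Fin 2) F} (hA : M * A = A * M) (hB : M * B = B * M)
    (N : Matrix (Fin 2) (Fin 2) F) : A * B = B * A ∨ M * N = N * M := by
  simp only [← Matrix.ext_iff, Fin.forall_fin_two, Matrix.mul_apply, Fin.sum_univ_two] at *
  obtain ⟨⟨a1, a2⟩, a3, a4⟩ := hA
  obtain ⟨⟨b1, b2⟩, b3, b4⟩ := hB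
  by_cases hq : M 0 1 = 0
  · by_cases hr : M 1 0 = 0
    · by_cases hp : M 0 0 - M 1 1 = 0
      · right
        rw [hq, hr, sub_eq_zero.1 hp]
        refine ⟨⟨?_, ?_⟩, ?_, ?_⟩ <;> ring
      · left
        have e1 : A 0 1 = 0 := mul_left_cancel₀ hp (by rw [hq] at a2; linear_combination a2)
        have e2 : A 1 0 = 0 := mul_left_cancel₀ hp (by rw [hr] at a3; linear_combination -a3)
        have e3 : B 0 1 = 0 := mul_left_cancel₀ hp (by rw [hq] at b2; linear_combination b2)
        have e4 : B 1 0 = 0 := mul_left_cancel₀ hp (by rw [hr] at b3; linear_combination -b3)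
        rw [e1, e2, e3, e4]
        refine ⟨⟨?_, ?_⟩, ?_, ?_⟩ <;> ring
    · left
      refine ⟨⟨?_, ?_⟩, ?_, ?_⟩ <;> apply mul_left_cancel₀ hr
      · linear_combination A 1 0 * b1 - B 1 0 * a1
      · linear_combination B 0 1 * a3 + (B 0 0 - B 1 1) * a1 + A 1 0 * b2
      · linear_combination A 1 0 * b3 - B 1 0 * a3
      · linear_combination B 1 0 * a1 - A 1 0 * b1
  · left
    refine ⟨⟨?_, ?_⟩, ?_, ?_⟩ <;> apply mul_left_cancel₀ hq
    · linear_combination A 0 1 * b1 - B 0 1 * a1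
    · linear_combination A 0 1 * b2 - B 0 1 * a2
    · linear_combination (B 0 0 - B 1 1) * a1 + A 0 1 * b3 + B 1 0 * a2
    · linear_combination B 0 1 * a1 - A 0 1 * b1

theorem three_le_of_injective {F : Type*} [Field F] {d : ℕ} (ρ : PathRAAG →* GL (Fin d) F)
    (hρ : Function.Injective ρ) : 3 ≤ d := by
  have key : ∀ M A B N : Matrix (Fin d) (Fin d) F, d ≤ 2 → M * A = A * M → M * B = B * M →
      A * B = B * A ∨ M * N = N * M := by
    intro M A B N hd hA hB
    interval_cases d
    · exact .inl (Subsingleton.elim _ _)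
    · left
      ext i j
      fin_cases i; fin_cases j
      simp [Matrix.mul_apply, mul_comm]
    · exact Matrix.mul_comm_or_mul_comm_of_fin_two hA hB N
  by_contra! hd
  have h10 : Commute (RAAG.of 1 : PathRAAG) (RAAG.of 0) :=
    RAAG.commute_of (by simp [SimpleGraph.pathGraph_adj])
  have h12 : Commute (RAAG.of 1 : PathRAAG) (RAAG.of 2) :=
    RAAG.commute_of (by simp [SimpleGraph.pathGraph_adj])
  have h02 : ¬ Commute (RAAG.of 0 : PathRAAG) (RAAG.of 2) :=
    RAAG.not_commute_of (by decide) (by simp [SimpleGraph.pathGraph_adj])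
  have h13 : ¬ Commute (RAAG.of 1 : PathRAAG) (RAAG.of 3) :=
    RAAG.not_commute_of (by decide) (by simp [SimpleGraph.pathGraph_adj])
  rcases key (ρ (RAAG.of 1)) (ρ (RAAG.of 0)) (ρ (RAAG.of 2)) (ρ (RAAG.of 3)) (by omega)
    (congrArg Units.val (h10.map ρ).eq) (congrArg Units.val (h12.map ρ).eq) with h | h
  · exact h02 (hρ (by rw [map_mul, map_mul]; exact Units.ext h))
  · exact h13 (hρ (by rw [map_mul, map_mul]; exact Units.ext h))

/-! ### Existence over the required fields and conclusion. -/

theorem exists_algebraicIndependent_pair {k₀ F ι : Type*} [Field k₀] [Field F] [Algebra k₀ F]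
    [Nontrivial ι] {x : ι → F} (hx : AlgebraicIndependent k₀ x) :
    ∃ t l : F, AlgebraicIndependent k₀ ![t, l] := by
  obtain ⟨i, j, hij⟩ := exists_pair_ne ι
  refine ⟨x i, x j, ?_⟩
  convert! hx.comp ![i, j] (by
    intro a b hab
    fin_cases a <;> fin_cases b <;> simp_all) using 1
  ext a
  fin_cases a <;> rfl

theorem exists_admissible_complex :
    ∃ G₀ Q₀ P₀ F₀ : Matrix (Fin 3) (Fin 3) ℂ, AdmissibleQuadruple G₀ Q₀ P₀ F₀ := by
  obtain ⟨ι, x, hx⟩ := exists_isTranscendenceBasis' ℚ ℂ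
  have hc := IsAlgClosed.cardinal_eq_cardinal_transcendence_basis_of_aleph0_lt' x hx (by simp)
    (by rw [Cardinal.mk_complex]; exact Cardinal.aleph0_lt_continuum)
  have : Infinite ι := by
    rw [Cardinal.infinite_iff, ← hc, Cardinal.mk_complex]
    exact Cardinal.aleph0_le_continuum
  obtain ⟨t, l, h⟩ := exists_algebraicIndependent_pair hx.1
  exact ⟨_, _, _, _, admissible_of_algebraicIndependent h⟩

theorem IsUniversalDomain.exists_admissible {F : Type*} [Field F] (h : IsUniversalDomain F) :
    ∃ G₀ Q₀ P₀ F₀ : Matrix (Fin 3) (Fin 3) F, AdmissibleQuadruple G₀ Q₀ P₀ F₀ := by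
  obtain ⟨ι, x, hx⟩ := exists_isTranscendenceBasis' (⊥ : Subfield F) F
  have : Infinite ι := by
    rw [Cardinal.infinite_iff, hx.cardinalMk_eq_trdeg]
    exact h.2
  obtain ⟨t, l, h⟩ := exists_algebraicIndependent_pair hx.1
  exact ⟨_, _, _, _, admissible_of_algebraicIndependent h⟩

/-- Three independent transcendentals are adjoined: two for the explicit quadruple over `E`, and a
third, `s`, for the deformation over `K`. -/
theorem exists_faithful_of_charP (p : ℕ) (k : Type u) [Field k] [CharP k p] :
    ∃ (F : Type u) (_ : Field F) (_ : CharP F p) (ρ : PathRAAG →* GL (Fin 3) F),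
      Function.Injective ρ := by
  let E := FractionRing (MvPolynomial (Fin 2) k)
  let K := FractionRing (Polynomial E)
  have hx : AlgebraicIndependent k (fun i : Fin 2 => algebraMap (MvPolynomial (Fin 2) k) E
      (MvPolynomial.X i)) :=
    (MvPolynomial.algebraicIndependent_X (Fin 2) k).map'
      (f := IsScalarTower.toAlgHom k (MvPolynomial (Fin 2) k) E) (IsFractionRing.injective _ _)
  obtain ⟨t, l, h⟩ := exists_algebraicIndependent_pair hx
  have hl : l ≠ 0 := h.ne_zero 1
  obtain ⟨h1, h2⟩ := explicit_conditions h hl (explicit_det_ne_zero t)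
  have hs : Transcendental E (algebraMap (Polynomial E) K Polynomial.X) := by
    rw [transcendental_iff_injective]
    intro p q hpq
    simpa [Polynomial.aeval_algebraMap_apply] using hpq
  have hs0 : algebraMap (Polynomial E) K Polynomial.X ≠ 0 := by simp
  have : CharP E p := charP_of_injective_algebraMap (algebraMap k E).injective p
  refine ⟨K, inferInstance, charP_of_injective_algebraMap (algebraMap E K).injective p, _,
    pathRep_injective (l := Units.mk0 l hl) (s := Units.mk0 _ hs0) hs h1 h2⟩

theorem exists_faithful (p : ℕ) (hp : p = 0 ∨ p.Prime) :
    ∃ (F : Type u) (_ : Field F) (_ : CharP F p) (ρ : PathRAAG →* GL (Fin 3) F),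
      Function.Injective ρ := by
  rcases hp with rfl | hp
  · exact exists_faithful_of_charP 0 (ULift.{u} ℚ)
  · have := Fact.mk hp
    exact exists_faithful_of_charP p (ULift.{u} (ZMod p))

theorem minDim_pathRAAG : minDim.{u} PathRAAG = 3 := by
  obtain ⟨F, hF, -, ρ, hρ⟩ := exists_faithful.{u} 0 (.inl rfl)
  refine le_antisymm (sInf_le ⟨3, rfl, F, hF, ρ, hρ⟩) (le_sInf ?_)
  rintro _ ⟨d, rfl, F, hF, ρ, hρ⟩
  exact_mod_cast three_le_of_injective ρ hρ

theorem minDimChar_pathRAAG (p : ℕ) (hp : p = 0 ∨ p.Prime) : minDimChar.{u} p PathRAAG = 3 := by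
  obtain ⟨F, hF, hFp, ρ, hρ⟩ := exists_faithful.{u} p hp
  refine le_antisymm (sInf_le ⟨3, rfl, F, hF, hFp, ρ, hρ⟩) (le_sInf ?_)
  rintro _ ⟨d, rfl, F, hF, -, ρ, hρ⟩
  exact_mod_cast three_le_of_injective ρ hρ

theorem mainTheorem6 :
    -- over the complex numbers
    (∃ G₀ Q₀ P₀ F₀ : Matrix (Fin 3) (Fin 3) ℂ, AdmissibleQuadruple G₀ Q₀ P₀ F₀) ∧
    -- over every universal coefficient domain of prime characteristic
    (∀ p : ℕ, p.Prime → ∀ (F : Type u) [Field F] [CharP F p], IsUniversalDomain F →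
      ∃ G₀ Q₀ P₀ F₀ : Matrix (Fin 3) (Fin 3) F, AdmissibleQuadruple G₀ Q₀ P₀ F₀) ∧
    -- an explicit choice, in every characteristic
    (∀ (F : Type u) [Field F] (t l : F), AlgebraicIndependent (⊥ : Subfield F) ![t, l] →
      AdmissibleQuadruple
        !![t ^ 4 + t ^ 2 - 1, (t - 1) * (t ^ 2 + 1), 0;
           (t + 1) * (t ^ 2 + 1), t ^ 2, 0;
           0, 0, 1]
        !![l, 0, 0; 0, l, 0; 0, 0, l⁻¹]
        !![l, 0, 0; 0, l⁻¹, 0; 0, 0, l]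
        !![t ^ 4 + t ^ 2 - 1, 0, (t - 1) * (t ^ 2 + 1);
           0, 1, 0;
           (t + 1) * (t ^ 2 + 1), 0, t ^ 2]) ∧
    -- the minimal dimensions
    minDim.{u} PathRAAG = 3 ∧
    (∀ p : ℕ, p = 0 ∨ p.Prime → minDimChar.{u} p PathRAAG = 3) := by
  exact ⟨exists_admissible_complex, fun _ _ _ _ _ h => h.exists_admissible,
    fun _ _ _ _ h => admissible_of_algebraicIndependent h, minDim_pathRAAG, minDimChar_pathRAAG⟩
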